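/- Let $Y$ and $U$ be (real or complex) Hilbert spaces, let $A:D(A)\subset Y\to Y$ generate a $C_0$-semigroup $\{S(t)\}_{t\ge 0}$ on $Y$, and let $B\in\mathcal L(U;Y)$. Consider the control system $y'(t)=Ay(t)+Bu(t)$, $t>0$, whose solution with initial state $y_0\in Y$ and control $u$ is the mild solution $y(t)=S(t)y_0+\int_0^tS(t-s)Bu(s)\,ds$. For $T>0$ put $(H_Ty)(t):=y([t/T]T)$, where $[r]$ is the largest integer $n\in\{0,1,2,\dots\}$ with $n\le r$. The system is called **(DC)**$_T$-stabilizable if there is an $F\in\mathcal L(Y;U)$ such that the closed-loop system $y'(t)=Ay(t)+BF(H_Ty)(t)$, $t>0$, is exponentially stable, i.e., there are $M>0$ and $\omega>0$ such that for every $y_0\in Y$ the solution with $y(0)=y_0$ satisfies $\|y(t)\|_Y\le Me^{-\omega t}\|y_0\|_Y$ for all $t\ge 0$. Then the system is **(DC)**$_T$-stabilizable for all $T>0$ if and only if for each $T>0$ there are constants $N\in\{1,2,\dots\}$, $\delta\in(0,1)$ and $C\ge 0$ such that $$\|S(NT)^*\varphi\|_Y^2\le C\sum_{i=1}^{N}\Big\|\int_{(i-1)T}^{iT}B^*S(t)^*\varphi\,dt\Big\|_U^2+\delta\|\varphi\|_Y^2\quad\text{for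 all }\varphi\in Y.$$ -/

import Mathlib

open Set Filter Topology MeasureTheory

/-- A strongly continuous (`C₀`) semigroup `{S(t)}_{t ≥ 0}` of bounded linear operators on `Y`.
It is stored as a function on `ℝ`; its values at negative times carry no condition and are
never used. -/
structure C0Semigroup (𝕜 : Type*) [RCLike 𝕜] (Y : Type*) [NormedAddCommGroup Y]
    [NormedSpace 𝕜 Y] where
  /-- the operator `S(t)` -/
  op : ℝ → (Y →L[𝕜] Y)
  op_zero : op 0 = ContinuousLinearMap.id 𝕜 Y
  op_add : ∀ s t : ℝ, 0 ≤ s → 0 ≤ t → op (s + t) = (op s).comp (op t)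
  continuousOn_orbit : ∀ x : Y, ContinuousOn (fun t : ℝ => op t x) (Ici 0)

/-- `A : D(A) ⊆ Y → Y` is the infinitesimal generator of `S`: `D(A)` consists exactly of those
`x` for which `(S(t) x - x) / t` converges in `Y` as `t → 0⁺`, and `A x` is that limit. -/
def C0Semigroup.IsGeneratedBy {𝕜 : Type*} [RCLike 𝕜] {Y : Type*} [NormedAddCommGroup Y]
    [NormedSpace 𝕜 Y] (S : C0Semigroup 𝕜 Y) (A : Y →ₗ.[𝕜] Y) : Prop :=
  (∀ x : Y, x ∈ A.domain ↔
    ∃ z : Y, Tendsto (fun t : ℝ => ((t⁻¹ : ℝ) : 𝕜) • (S.op t x - x)) (𝓝[>] 0) (𝓝 z)) ∧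
  ∀ x : A.domain,
    Tendsto (fun t : ℝ => ((t⁻¹ : ℝ) : 𝕜) • (S.op t (x : Y) - (x : Y))) (𝓝[>] 0) (𝓝 (A x))

/-- The control system `y'(t) = A y(t) + B u(t)`, `t > 0`, with `A : D(A) ⊆ Y → Y` the generator
of a `C₀`-semigroup `S` on `Y` and `B : U → Y` a bounded linear operator. -/
structure ControlSystem (𝕜 : Type*) [RCLike 𝕜] (Y U : Type*) [NormedAddCommGroup Y]
    [NormedSpace 𝕜 Y] [NormedAddCommGroup U] [NormedSpace 𝕜 U] where
  A : Y →ₗ.[𝕜] Y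
  S : C0Semigroup 𝕜 Y
  generates : S.IsGeneratedBy A
  B : U →L[𝕜] Y

/-- The `T`-periodic sampling operator `(H_T f)(t) = f([t / T] T)`, for `t ≥ 0`. -/
noncomputable def samplePeriodic {Y : Type*} (T : ℝ) (f : ℝ → Y) (t : ℝ) : Y :=
  f ((⌊t / T⌋₊ : ℝ) * T)

namespace ControlSystem

variable {𝕜 : Type*} [RCLike 𝕜] {Y U : Type*}
  [NormedAddCommGroup Y] [InnerProductSpace 𝕜 Y] [CompleteSpace Y] [NormedSpace ℝ Y]
  [NormedAddCommGroup U] [InnerProductSpace 𝕜 U] [CompleteSpace U] [NormedSpace ℝ U]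

/-- `y` is the (mild) solution of `y'(t) = A y(t) + B u(t)` on `[0, ∞)`, for the control `u` and
with the initial state `y₀`: it is continuous and satisfies the variation of constants formula.
(Only the values of `u` and `y` at nonnegative times matter.) -/
def IsSolution (sys : ControlSystem 𝕜 Y U) (u : ℝ → U) (y₀ : Y) (y : ℝ → Y) : Prop :=
  (∀ t : ℝ, 0 ≤ t → IntervalIntegrable u volume 0 t) ∧
  ContinuousOn y (Ici 0) ∧
  ∀ t : ℝ, 0 ≤ t → y t = sys.S.op t y₀ + ∫ s in (0 : ℝ)..t, sys.S.op (t - s) (sys.B (u s))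

/-- `y` solves the sampled-data closed-loop system `y'(t) = A y(t) + B F (H_T y)(t)`,
with `y(0) = y₀`. -/
def IsSampledClosedLoopSolution (sys : ControlSystem 𝕜 Y U) (T : ℝ) (F : Y →L[𝕜] U)
    (y₀ : Y) (y : ℝ → Y) : Prop :=
  sys.IsSolution (fun t => F (samplePeriodic T y t)) y₀ y

/-- The system is **(DC)**_T-stabilizable: for some bounded linear feedback `F : Y → U` the
closed-loop system `y'(t) = A y(t) + B F (H_T y)(t)` is exponentially stable, that is, it has a
solution for each initial state, and all of its solutions decay exponentially, at a common rate
and with a common constant. -/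
def IsDCStabilizable (sys : ControlSystem 𝕜 Y U) (T : ℝ) : Prop :=
  ∃ F : Y →L[𝕜] U, ∃ M ω : ℝ, 0 < M ∧ 0 < ω ∧ ∀ y₀ : Y,
    (∃ y : ℝ → Y, sys.IsSampledClosedLoopSolution T F y₀ y) ∧
    ∀ y : ℝ → Y, sys.IsSampledClosedLoopSolution T F y₀ y →
      ∀ t : ℝ, 0 ≤ t → ‖y t‖ ≤ M * Real.exp (-ω * t) * ‖y₀‖

end ControlSystem

/-! The equivalence holds for each `T` separately. Under a constant control on each period, the
states at multiples of `T` obey `x (k + 1) = P (x k) + G (u k)`, with `P = S(T)` and `G u = ∫₀ᵀ S(s)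
B u ds`. Between samples the state is bounded by a constant times the last sample, so
stabilizability means that some `P + G F` is power stable
(`isDCStabilizable_iff_exists_powerStable`). The adjoint integral over the `k`-th period (counted
from 0) is `G* (P*)ᵏ φ` (`integral_adjoint_op`), so the inequality becomes a discrete observability
inequality.

From feedback to inequality: `(P*)ᴺ` differs from `((P + G F)*)ᴺ` only by terms passing through the
observations `G* (P*)ⁱ φ`, and the latter power is small for large `N`.

From inequality to feedback: a regularized Gramian gives an `N`-step control that contracts the
state. Repeating it yields a square-summable trajectory from every initial state, but the control
depends on the position in the block. A time-invariant feedback comes from the minimal-norm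
trajectories: they depend linearly on the initial state, and their tails are again minimal. The
closed loop follows them, so its orbits are square-summable, which forces power stability. -/

set_option linter.unusedSectionVars false

section Discrete

open ContinuousLinearMap
open scoped InnerProductSpace ENNReal

variable {𝕜 : Type*} [RCLike 𝕜] {Y U : Type*}
  [NormedAddCommGroup Y] [InnerProductSpace 𝕜 Y]
  [NormedAddCommGroup U] [InnerProductSpace 𝕜 U]

theorem clm_mul_apply (f g : Y →L[𝕜] Y) (x : Y) : (f * g) x = f (g x) := rfl

/-! ### Square-summable sequences and their shifts. -/

/-- Square-summable sequences. -/
abbrev SquareSummableSeq (X : Type*) [NormedAddCommGroup X] : Type _ := lp (fun _ : ℕ => X) 2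

theorem memℓp_two_iff_summable_sq {X : Type*} [NormedAddCommGroup X] {f : ℕ → X} :
    Memℓp f 2 ↔ Summable fun k => ‖f k‖ ^ 2 := by
  rw [memℓp_gen_iff (by norm_num)]
  norm_num

namespace SquareSummableSeq

variable {X : Type*} [NormedAddCommGroup X]

/-- The backward shift `(z₀, z₁, …) ↦ (z₁, z₂, …)`. -/
def tail (z : SquareSummableSeq X) : SquareSummableSeq X :=
  ⟨fun k => z (k + 1), memℓp_two_iff_summable_sq.2
    ((summable_nat_add_iff 1).2 (memℓp_two_iff_summable_sq.1 z.2))⟩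

/-- The sequence `(0, z₀, z₁, …)`. -/
def consZeroFun (z : ℕ → X) : ℕ → X
  | 0 => 0
  | k + 1 => z k

theorem memℓp_consZeroFun {z : ℕ → X} (hz : Memℓp z 2) : Memℓp (consZeroFun z) 2 := by
  rw [memℓp_two_iff_summable_sq] at hz ⊢
  exact (summable_nat_add_iff 1).1 hz

/-- The forward shift `(z₀, z₁, …) ↦ (0, z₀, z₁, …)`. -/
def consZero (z : SquareSummableSeq X) : SquareSummableSeq X :=
  ⟨consZeroFun z, memℓp_consZeroFun z.2⟩

@[simp] theorem tail_apply (z : SquareSummableSeq X) (k : ℕ) : tail z k = z (k + 1) := rfl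

@[simp] theorem consZero_zero (z : SquareSummableSeq X) : consZero z 0 = 0 := rfl

@[simp] theorem consZero_succ (z : SquareSummableSeq X) (k : ℕ) : consZero z (k + 1) = z k := rfl

/-- The two shifts are adjoint to each other; this is what shows that the tail of a minimal
trajectory is minimal. -/
theorem inner_consZero [InnerProductSpace 𝕜 X] (w z : SquareSummableSeq X) :
    ⟪consZero w, z⟫_𝕜 = ⟪w, tail z⟫_𝕜 := by
  let f : ℕ → X := consZero w
  let g : ℕ → X := z
  have h := (lp.summable_inner (𝕜 := 𝕜) (consZero w) z).tsum_eq_zero_add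
  have h0 : inner 𝕜 (f 0) (g 0) = 0 := inner_zero_left _
  calc ⟪consZero w, z⟫_𝕜 = ∑' k, inner 𝕜 (f k) (g k) := lp.inner_eq_tsum _ _
    _ = inner 𝕜 (f 0) (g 0) + ∑' k, inner 𝕜 (f (k + 1)) (g (k + 1)) := h
    _ = ∑' k, inner 𝕜 (f (k + 1)) (g (k + 1)) := by rw [h0, zero_add]
    _ = ⟪w, tail z⟫_𝕜 := (lp.inner_eq_tsum w (tail z)).symm

theorem sum_sq_norm_le (z : SquareSummableSeq X) (n : ℕ) :
    ∑ k ∈ Finset.range n, ‖z k‖ ^ 2 ≤ ‖z‖ ^ 2 := by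
  simpa using lp.sum_rpow_le_norm_rpow (p := 2) (by norm_num) z (Finset.range n)

end SquareSummableSeq

/-! ### Minimal trajectories, feedback and power stability. -/

open SquareSummableSeq

/-- The square-summable pairs `(y, u)` of states and controls with `y (k + 1) = P (y k) + G (u k)`. -/
noncomputable def squareSummableTrajectories (P : Y →L[𝕜] Y) (G : U →L[𝕜] Y) :
    Submodule 𝕜 (SquareSummableSeq (WithLp 2 (Y × U))) :=
  ⨅ k : ℕ, ((WithLp.fstL 2 𝕜 Y U) ∘L (lp.evalCLM 𝕜 (fun _ => WithLp 2 (Y × U)) 2 (k + 1))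
    - (P ∘L WithLp.fstL 2 𝕜 Y U + G ∘L WithLp.sndL 2 𝕜 Y U) ∘L
      (lp.evalCLM 𝕜 (fun _ => WithLp 2 (Y × U)) 2 k)).ker

theorem mem_squareSummableTrajectories {P : Y →L[𝕜] Y} {G : U →L[𝕜] Y}
    {z : SquareSummableSeq (WithLp 2 (Y × U))} :
    z ∈ squareSummableTrajectories P G ↔ ∀ k, (z (k + 1)).fst = P (z k).fst + G (z k).snd := by
  simp only [squareSummableTrajectories, Submodule.mem_iInf, LinearMap.mem_ker]
  refine forall_congr' fun k => ?_
  exact sub_eq_zero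

theorem isClosed_squareSummableTrajectories (P : Y →L[𝕜] Y) (G : U →L[𝕜] Y) :
    IsClosed (squareSummableTrajectories P G : Set (SquareSummableSeq (WithLp 2 (Y × U)))) := by
  rw [squareSummableTrajectories, Submodule.coe_iInf]
  exact isClosed_iInter fun k => ContinuousLinearMap.isClosed_ker _

theorem ContinuousLinearMap.eq_of_inner_ker_eq_zero {Z : Type*} [NormedAddCommGroup Z]
    [InnerProductSpace 𝕜 Z] (e : Z →L[𝕜] Y) {a b : Z} (ha : ∀ w, e w = 0 → ⟪w, a⟫_𝕜 = 0)
    (hb : ∀ w, e w = 0 → ⟪w, b⟫_𝕜 = 0) (h : e a = e b) : a = b := by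
  have hab : e (a - b) = 0 := by rw [map_sub, h, sub_self]
  rw [← sub_eq_zero, ← inner_self_eq_zero (𝕜 := 𝕜), inner_sub_right, ha _ hab, hb _ hab, sub_zero]

/-- A surjective bounded operator between Hilbert spaces has a bounded right inverse with values
in the orthogonal complement of its kernel. -/
theorem ContinuousLinearMap.exists_rightInverse_orthogonal_ker {Z : Type*} [NormedAddCommGroup Z]
    [InnerProductSpace 𝕜 Z] [CompleteSpace Z] [CompleteSpace Y] (e : Z →L[𝕜] Y)
    (he : Function.Surjective e) :
    ∃ R : Y →L[𝕜] Z, (∀ x, e (R x) = x) ∧ ∀ x w, e w = 0 → ⟪w, R x⟫_𝕜 = 0 := by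
  have : CompleteSpace e.ker := e.isClosed_ker.completeSpace_coe
  let e' : (e.ker)ᗮ →L[𝕜] Y := e ∘L (e.ker)ᗮ.subtypeL
  have he' : ∀ z, e' z = e z.1 := fun z => rfl
  have hinj : Function.Injective e' := fun a b hab =>
    Subtype.ext (e.eq_of_inner_ker_eq_zero
      (fun w hw => Submodule.inner_right_of_mem_orthogonal (K := e.ker) hw a.2)
      (fun w hw => Submodule.inner_right_of_mem_orthogonal (K := e.ker) hw b.2) hab)
  have hsurj : Function.Surjective e' := by
    intro x
    obtain ⟨z, hx⟩ := he x
    obtain ⟨a, ha, b, hb, hab⟩ := e.ker.exists_add_mem_mem_orthogonal z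
    refine ⟨⟨b, hb⟩, ?_⟩
    have h3 : e a = 0 := ha
    rw [he', ← hx, hab, map_add, h3, zero_add]
  have hker := LinearMap.ker_eq_bot.2 hinj
  have hran := LinearMap.range_eq_top.2 hsurj
  let R : Y ≃L[𝕜] (e.ker)ᗮ :=
    (ContinuousLinearEquiv.ofBijective e' hker hran).symm
  refine ⟨(e.ker)ᗮ.subtypeL ∘L R.toContinuousLinearMap, fun x => ?_, fun x w hw => ?_⟩
  · exact ContinuousLinearEquiv.ofBijective_apply_symm_apply e' hker hran x
  · exact Submodule.inner_right_of_mem_orthogonal (K := e.ker) hw (R x).2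

/-- Bellman's principle without a Riccati equation. `R x` is the trajectory of least norm from `x`,
characterized by orthogonality to all trajectories starting at state 0, and `F x` is its first
control. Since `R x` runs along the orbit of `P + G F`, its norm bounds the sum. -/
theorem exists_feedback_sum_sq_le [CompleteSpace Y] [CompleteSpace U]
    (P : Y →L[𝕜] Y) (G : U →L[𝕜] Y)
    (h : ∀ x, ∃ z ∈ squareSummableTrajectories P G, (z 0).fst = x) :
    ∃ F : Y →L[𝕜] U, ∃ c : ℝ, 0 ≤ c ∧ ∀ x n,
      ∑ k ∈ Finset.range n, ‖((P + G ∘L F) ^ k) x‖ ^ 2 ≤ c * ‖x‖ ^ 2 := by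
  set Z := squareSummableTrajectories P G
  have : CompleteSpace Z := (isClosed_squareSummableTrajectories P G).completeSpace_coe
  let ev : Z →L[𝕜] WithLp 2 (Y × U) :=
    (lp.evalCLM 𝕜 (fun _ => WithLp 2 (Y × U)) 2 0) ∘L Z.subtypeL
  let e : Z →L[𝕜] Y := (WithLp.fstL 2 𝕜 Y U) ∘L ev
  obtain ⟨R, hR, hRorth⟩ := e.exists_rightInverse_orthogonal_ker fun x => by
    obtain ⟨z, hz, hx⟩ := h x
    exact ⟨⟨z, hz⟩, hx⟩
  let F : Y →L[𝕜] U := (WithLp.sndL 2 𝕜 Y U) ∘L ev ∘L R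
  have hF : ∀ x, F x = ((R x).1 0).snd := fun x => rfl
  have hRx : ∀ x, ((R x).1 0).fst = x := hR
  have hstep : ∀ x, (R ((P + G ∘L F) x)).1 = tail (R x).1 := by
    intro x
    have hmem : tail (R x).1 ∈ Z := by
      refine mem_squareSummableTrajectories.2 fun k => ?_
      exact mem_squareSummableTrajectories.1 (R x).2 (k + 1)
    have horth : ∀ w, e w = 0 → ⟪w, (⟨_, hmem⟩ : Z)⟫_𝕜 = 0 := by
      intro w hw
      have hw0 : (w.1 0).fst = 0 := hw
      -- Waiting one step at state 0 with control 0 before following `w` is admissible because `w`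
      -- itself starts at state 0. Orthogonality of `R x` to this delayed trajectory is
      -- orthogonality of its tail to `w`.
      have hc : consZero w.1 ∈ Z := by
        refine mem_squareSummableTrajectories.2 ?_
        rintro (_ | k)
        · simp [hw0]
        · exact mem_squareSummableTrajectories.1 w.2 k
      have hck : e (⟨_, hc⟩ : Z) = 0 := by
        change (consZero w.1 0).fst = 0
        simp
      have := hRorth x _ hck
      rw [Submodule.coe_inner] at this ⊢
      rw [← this]
      exact (inner_consZero w.1 (R x).1).symm
    have : R ((P + G ∘L F) x) = ⟨_, hmem⟩ := by
      refine e.eq_of_inner_ker_eq_zero (hRorth _) horth ?_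
      rw [hR]
      change _ = ((R x).1 (0 + 1)).fst
      rw [mem_squareSummableTrajectories.1 (R x).2 0, hRx, ← hF]
      rfl
    rw [this]
  have hpow : ∀ k x j, (R (((P + G ∘L F) ^ k) x)).1 j = (R x).1 (j + k) := by
    intro k
    induction k with
    | zero => intro x j; simp
    | succ k ih =>
      intro x j
      have h1 : ((P + G ∘L F) ^ (k + 1)) x = (P + G ∘L F) (((P + G ∘L F) ^ k) x) := by
        rw [pow_succ', clm_mul_apply]
      have h2 : j + (k + 1) = j + 1 + k := by omega
      rw [h1, hstep, tail_apply, ih, h2]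
  refine ⟨F, ‖R‖ ^ 2, by positivity, fun x n => ?_⟩
  calc ∑ k ∈ Finset.range n, ‖((P + G ∘L F) ^ k) x‖ ^ 2
      ≤ ∑ k ∈ Finset.range n, ‖(R x).1 k‖ ^ 2 := by
        refine Finset.sum_le_sum fun k _ => ?_
        have h1 := hpow k x 0
        rw [zero_add] at h1
        have h2 := hRx (((P + G ∘L F) ^ k) x)
        rw [h1] at h2
        rw [WithLp.prod_norm_sq_eq_of_L2, h2]
        linarith [sq_nonneg ‖((R x).1 k).snd‖]
    _ ≤ ‖(R x).1‖ ^ 2 := sum_sq_norm_le _ _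
    _ ≤ (‖R‖ * ‖x‖) ^ 2 := by
        gcongr
        exact R.le_opNorm x
    _ = _ := by ring

/-- A bounded operator all of whose orbits are square-summable is power stable. -/
theorem exists_norm_pow_le_exp {L : Y →L[𝕜] Y} {c : ℝ} (hc : 0 ≤ c)
    (h : ∀ x n, ∑ k ∈ Finset.range n, ‖(L ^ k) x‖ ^ 2 ≤ c * ‖x‖ ^ 2) :
    ∃ M ω : ℝ, 0 < M ∧ 0 < ω ∧ ∀ n : ℕ, ‖L ^ n‖ ≤ M * Real.exp (-ω * n) := by
  have hb : ∀ n x, ‖(L ^ n) x‖ ^ 2 ≤ c * ‖x‖ ^ 2 := fun n x =>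
    (Finset.single_le_sum (f := fun k => ‖(L ^ k) x‖ ^ 2) (fun _ _ => sq_nonneg _)
      (Finset.mem_range.2 n.lt_succ_self)).trans (h x (n + 1))
  -- Datko's argument: `‖Lⁿ x‖²` is at most `c ‖Lᵏ x‖²` for each `k < n`, and summing over `k` uses
  -- the hypothesis a second time.
  have hn : ∀ n : ℕ, ∀ x, n * ‖(L ^ n) x‖ ^ 2 ≤ c ^ 2 * ‖x‖ ^ 2 := by
    intro n x
    calc n * ‖(L ^ n) x‖ ^ 2 = ∑ k ∈ Finset.range n, ‖(L ^ n) x‖ ^ 2 := by simp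
      _ ≤ ∑ k ∈ Finset.range n, c * ‖(L ^ k) x‖ ^ 2 := by
        refine Finset.sum_le_sum fun k hk => ?_
        have : L ^ n = L ^ (n - k) * L ^ k := by
          rw [← pow_add, Nat.sub_add_cancel (Finset.mem_range.1 hk).le]
        rw [this, clm_mul_apply]
        exact hb _ _
      _ ≤ c * (c * ‖x‖ ^ 2) := by
        rw [← Finset.mul_sum]
        exact mul_le_mul_of_nonneg_left (h x n) hc
      _ = _ := by ring
  obtain ⟨m, hm⟩ := exists_nat_gt (4 * c ^ 2)
  have hm0 : (0 : ℝ) < m := lt_of_le_of_lt (by positivity) hm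
  have hhalf : ‖L ^ m‖ ≤ 1 / 2 := by
    refine opNorm_le_bound _ (by norm_num) fun x => ?_
    refine abs_le_of_sq_le_sq' ?_ (by positivity) |>.2
    have h1 := hn m x
    have h2 : c ^ 2 * ‖x‖ ^ 2 ≤ m * (‖x‖ ^ 2 / 4) := by nlinarith [sq_nonneg ‖x‖]
    have := le_of_mul_le_mul_left (h1.trans h2) hm0
    linarith [this, (by ring : (1 / 2 * ‖x‖) ^ 2 = ‖x‖ ^ 2 / 4)]
  have hbn : ∀ n, ‖L ^ n‖ ≤ c + 1 := by
    intro n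
    refine opNorm_le_bound _ (by positivity) fun x => ?_
    refine abs_le_of_sq_le_sq' ?_ (by positivity) |>.2
    have := hb n x
    nlinarith [sq_nonneg ‖x‖, mul_nonneg hc (sq_nonneg ‖x‖), mul_nonneg (sq_nonneg c) (sq_nonneg ‖x‖)]
  -- The norm halves every `m` steps; `c + 1` bounds the remaining `n % m` steps and the factor 2
  -- pays for rounding `n / m` down.
  refine ⟨2 * (c + 1), Real.log 2 / m, by positivity, div_pos (Real.log_pos one_lt_two) hm0,
    fun n => ?_⟩
  have hdec : L ^ n = L ^ (n % m) * (L ^ m) ^ (n / m) := by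
    rw [← pow_mul, ← pow_add, Nat.mod_add_div]
  have hdiv : (n : ℝ) / m ≤ (n / m : ℕ) + 1 := by
    rw [div_le_iff₀ hm0]
    have hmN : 0 < m := by exact_mod_cast hm0
    have : n < (n / m + 1) * m := by
      have := Nat.div_add_mod n m
      have := Nat.mod_lt n hmN
      nlinarith
    exact_mod_cast this.le
  have hpow : (1 / 2 : ℝ) ^ (n / m) ≤ 2 * Real.exp (-(Real.log 2 / m) * n) := by
    have h1 : (1 / 2 : ℝ) ^ (n / m) = Real.exp (-Real.log 2 * (n / m : ℕ)) := by
      rw [mul_comm, Real.exp_nat_mul, Real.exp_neg, Real.exp_log two_pos, one_div]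
    have h2 : (2 : ℝ) * Real.exp (-(Real.log 2 / m) * n)
        = Real.exp (Real.log 2 + -(Real.log 2 / m) * n) := by
      rw [Real.exp_add, Real.exp_log two_pos]
    rw [h1, h2, Real.exp_le_exp]
    have h3 := mul_le_mul_of_nonneg_left hdiv (Real.log_pos one_lt_two).le
    have h4 : Real.log 2 / m * n = Real.log 2 * (n / m) := by ring
    linarith
  calc ‖L ^ n‖ ≤ ‖L ^ (n % m)‖ * ‖(L ^ m) ^ (n / m)‖ := by rw [hdec]; exact norm_mul_le _ _
    _ ≤ (c + 1) * (1 / 2) ^ (n / m) := by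
      refine mul_le_mul (hbn _) ?_ (norm_nonneg _) (by positivity)
      calc ‖(L ^ m) ^ (n / m)‖ ≤ ‖L ^ m‖ ^ (n / m) := by
            rcases Nat.eq_zero_or_pos (n / m) with h0 | h0
            · rw [h0, pow_zero, pow_zero]; exact norm_id_le
            · exact norm_pow_le' _ h0
        _ ≤ _ := by gcongr
    _ ≤ (c + 1) * (2 * Real.exp (-(Real.log 2 / m) * n)) := by gcongr
    _ = _ := by ring

theorem Summable.comp_nat_div {f : ℕ → ℝ} (hf : Summable f) (h0 : ∀ n, 0 ≤ f n) {N : ℕ}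
    (hN : 0 < N) : Summable fun k => f (k / N) := by
  have : NeZero N := ⟨hN.ne'⟩
  rw [← (Nat.divModEquiv N).symm.summable_iff]
  have := hf.mul_of_nonneg (g := fun _ : Fin N => (1 : ℝ)) Summable.of_finite h0
    (fun _ => zero_le_one)
  refine this.congr fun p => ?_
  have hp : ((Nat.divModEquiv N).symm p) / N = p.1 := by
    change (p.1 * N + p.2) / N = p.1
    rw [Nat.add_comm, Nat.add_mul_div_right _ _ hN, Nat.div_eq_of_lt p.2.2, zero_add]
  rw [mul_one, Function.comp_apply, hp]

/-- If an `N`-step feedback contracts the state, repeating it gives a square-summable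
trajectory from every initial state. -/
theorem exists_trajectory_of_block {P : Y →L[𝕜] Y} {G : U →L[𝕜] Y} {N : ℕ} (hN : 0 < N)
    (E : ℕ → Y →L[𝕜] Y) (K : ℕ → Y →L[𝕜] U) (hE0 : E 0 = 1)
    (hE : ∀ i, E (i + 1) = P ∘L E i + G ∘L K i) {r : ℝ} (hr0 : 0 ≤ r) (hr1 : r < 1)
    (hQ : ∀ x, ‖E N x‖ ^ 2 ≤ r * ‖x‖ ^ 2) (x : Y) :
    ∃ z ∈ squareSummableTrajectories P G, (z 0).fst = x := by
  have hQj : ∀ j, ‖((E N) ^ j) x‖ ^ 2 ≤ r ^ j * ‖x‖ ^ 2 := by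
    intro j
    induction j with
    | zero => simp
    | succ j ih =>
      rw [pow_succ' (E N), clm_mul_apply, pow_succ' r, mul_assoc]
      exact (hQ _).trans (mul_le_mul_of_nonneg_left ih hr0)
  let c : ℝ := ∑ i ∈ Finset.range N, (‖E i‖ ^ 2 + ‖K i‖ ^ 2)
  have hc : ∀ k, ‖E (k % N)‖ ^ 2 + ‖K (k % N)‖ ^ 2 ≤ c := fun k =>
    Finset.single_le_sum (f := fun i => ‖E i‖ ^ 2 + ‖K i‖ ^ 2) (fun _ _ => by positivity)
      (Finset.mem_range.2 (Nat.mod_lt _ hN))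
  -- At time `k`, `k / N` blocks are complete and the current one is at position `k % N`.
  let f : ℕ → WithLp 2 (Y × U) := fun k =>
    WithLp.toLp 2 (E (k % N) (((E N) ^ (k / N)) x), K (k % N) (((E N) ^ (k / N)) x))
  have hf : Summable fun k => ‖f k‖ ^ 2 := by
    have hs : Summable fun k : ℕ => c * ‖x‖ ^ 2 * r ^ (k / N) :=
      ((summable_geometric_of_lt_one hr0 hr1).comp_nat_div (fun n => by positivity) hN).mul_left _
    refine hs.of_nonneg_of_le (fun _ => sq_nonneg _) fun k => ?_
    rw [WithLp.prod_norm_sq_eq_of_L2]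
    set w := ((E N) ^ (k / N)) x with hw
    change ‖E (k % N) w‖ ^ 2 + ‖K (k % N) w‖ ^ 2 ≤ _
    have h1 : ‖E (k % N) w‖ ^ 2 ≤ ‖E (k % N)‖ ^ 2 * ‖w‖ ^ 2 := by
      rw [← mul_pow]; gcongr; exact le_opNorm _ _
    have h2 : ‖K (k % N) w‖ ^ 2 ≤ ‖K (k % N)‖ ^ 2 * ‖w‖ ^ 2 := by
      rw [← mul_pow]; gcongr; exact le_opNorm _ _
    have h3 : (‖E (k % N)‖ ^ 2 + ‖K (k % N)‖ ^ 2) * ‖w‖ ^ 2 ≤ c * (r ^ (k / N) * ‖x‖ ^ 2) :=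
      mul_le_mul (hc k) (hQj _) (sq_nonneg _) (le_trans (by positivity) (hc k))
    linarith
  refine ⟨⟨f, memℓp_two_iff_summable_sq.2 hf⟩, ?_, ?_⟩
  · rw [mem_squareSummableTrajectories]
    intro k
    change E ((k + 1) % N) (((E N) ^ ((k + 1) / N)) x) =
      P (E (k % N) (((E N) ^ (k / N)) x)) + G (K (k % N) (((E N) ^ (k / N)) x))
    have hEa : ∀ i w, P (E i w) + G (K i w) = E (i + 1) w := fun i w => by rw [hE]; rfl
    rw [hEa]
    by_cases hk : k % N + 1 = N
    · have h1 : (k + 1) = N * (k / N + 1) := by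
        have := Nat.mod_add_div k N
        rw [mul_add, mul_one]
        omega
      have h2 : (k + 1) % N = 0 := by rw [h1, Nat.mul_mod_right]
      have h3 : (k + 1) / N = k / N + 1 := by rw [h1, Nat.mul_div_cancel_left _ hN]
      rw [hk, h2, h3, hE0, pow_succ']
      rfl
    · have hlt : k % N + 1 < N := lt_of_le_of_ne (Nat.mod_lt k hN) hk
      have h1 : (k + 1) = (k % N + 1) + N * (k / N) := by
        have := Nat.mod_add_div k N
        omega
      have h2 : (k + 1) % N = k % N + 1 := by
        rw [h1, Nat.add_mul_mod_self_left, Nat.mod_eq_of_lt hlt]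
      have h3 : (k + 1) / N = k / N := by
        rw [h1, Nat.add_mul_div_left _ _ hN, Nat.div_eq_of_lt hlt, zero_add]
      rw [h2, h3]
  · change E (0 % N) (((E N) ^ (0 / N)) x) = x
    simp [hE0]

/-! ### Discrete observability inequality and stabilizing feedback. -/

variable [CompleteSpace Y] [CompleteSpace U]

/-- With `W = C W₀ + δ`, where `W₀` is the `N`-step Gramian, the control built from `W⁻¹ Pᴺ x`
leaves the final state `Pᴺ x - C W₀ W⁻¹ Pᴺ x = δ W⁻¹ Pᴺ x`. The inequality makes its squared norm at
most `δ ‖x‖²`. -/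
theorem exists_trajectory_of_observability {P : Y →L[𝕜] Y} {G : U →L[𝕜] Y} {N : ℕ} (hN : 0 < N)
    {δ C : ℝ} (hδ0 : 0 < δ) (hδ1 : δ < 1) (hC : 0 ≤ C)
    (h : ∀ φ, ‖(adjoint P ^ N) φ‖ ^ 2 ≤
      C * ∑ i ∈ Finset.range N, ‖adjoint G ((adjoint P ^ i) φ)‖ ^ 2 + δ * ‖φ‖ ^ 2) (x : Y) :
    ∃ z ∈ squareSummableTrajectories P G, (z 0).fst = x := by
  have hadj : ∀ i φ ψ, ⟪(P ^ i) φ, ψ⟫_𝕜 = ⟪φ, (adjoint P ^ i) ψ⟫_𝕜 := by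
    intro i φ ψ
    rw [← adjoint_inner_right, ← star_eq_adjoint, ← star_eq_adjoint, star_pow]
  let W₀ : Y →L[𝕜] Y := 
    ∑ i ∈ Finset.range N, (P ^ i) ∘L G ∘L adjoint G ∘L (adjoint P ^ i)
  let W : Y →L[𝕜] Y := (C : 𝕜) • W₀ + (δ : 𝕜) • 1
  have hWin : ∀ ψ, ⟪W ψ, ψ⟫_𝕜 =
      ((C * ∑ i ∈ Finset.range N, ‖adjoint G ((adjoint P ^ i) ψ)‖ ^ 2 + δ * ‖ψ‖ ^ 2 : ℝ) : 𝕜) := by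
    intro ψ
    have h0 : ⟪W₀ ψ, ψ⟫_𝕜 =
        ∑ i ∈ Finset.range N, ((‖adjoint G ((adjoint P ^ i) ψ)‖ : 𝕜)) ^ 2 := by
      simp only [W₀, sum_apply, sum_inner]
      refine Finset.sum_congr rfl fun i _ => ?_
      simp only [comp_apply]
      rw [hadj, ← adjoint_inner_right, inner_self_eq_norm_sq_to_K]
    have h1 : W ψ = (C : 𝕜) • W₀ ψ + (δ : 𝕜) • ψ := rfl
    rw [h1, inner_add_left, inner_smul_left, inner_smul_left, h0, inner_self_eq_norm_sq_to_K,
      RCLike.conj_ofReal, RCLike.conj_ofReal, RCLike.ofReal_add, RCLike.ofReal_mul,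
      RCLike.ofReal_mul, RCLike.ofReal_sum, RCLike.ofReal_pow]
    simp only [RCLike.ofReal_pow]
  -- `W` is coercive with constant `δ`, hence invertible; this is where `δ > 0` is needed.
  have hunit : IsUnit W := by
    refine isUnit_of_forall_le_norm_inner_map W (c := ⟨δ, hδ0.le⟩) hδ0 fun ψ => ?_
    rw [hWin, RCLike.norm_ofReal]
    refine le_trans ?_ (le_abs_self _)
    have : 0 ≤ C * ∑ i ∈ Finset.range N, ‖adjoint G ((adjoint P ^ i) ψ)‖ ^ 2 := by positivity
    change ‖ψ‖ ^ 2 * δ ≤ _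
    linarith
  obtain ⟨V, hV⟩ := hunit.exists_right_inv
  let K : ℕ → Y →L[𝕜] U := fun j => -(C : 𝕜) • (adjoint G ∘L (adjoint P ^ (N - 1 - j)) ∘L V ∘L (P ^ N))
  let E : ℕ → Y →L[𝕜] Y := fun n => Nat.rec 1 (fun i e => P ∘L e + G ∘L K i) n
  have hE : ∀ i, E (i + 1) = P ∘L E i + G ∘L K i := fun i => rfl
  have hEsum : ∀ n, E n = P ^ n + ∑ j ∈ Finset.range n, (P ^ (n - 1 - j)) ∘L G ∘L K j := by
    intro n
    induction n with
    | zero => simp [E]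
    | succ n ih =>
      rw [hE, ih, Finset.sum_range_succ, pow_succ', comp_add, ← add_assoc]
      congr 1
      · congr 1
        ext w
        simp only [comp_apply, sum_apply, map_sum]
        refine Finset.sum_congr rfl fun j hj => ?_
        have : n + 1 - 1 - j = (n - 1 - j) + 1 := by have := Finset.mem_range.1 hj; omega
        rw [this, pow_succ']
        rfl
      · have : n + 1 - 1 - n = 0 := by omega
        rw [this, pow_zero]
        rfl
  have hEN : ∀ w, E N w = (δ : 𝕜) • V ((P ^ N) w) := by
    intro w
    have h1 : W (V ((P ^ N) w)) = (P ^ N) w := by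
      rw [← clm_mul_apply W, hV, one_apply_eq_self]
    have h2 : (∑ j ∈ Finset.range N, (P ^ (N - 1 - j)) ∘L G ∘L K j) w
        = -((C : 𝕜) • W₀ (V ((P ^ N) w))) := by
      rw [← Finset.sum_range_reflect]
      simp only [W₀, sum_apply, Finset.smul_sum, ← Finset.sum_neg_distrib]
      refine Finset.sum_congr rfl fun j hj => ?_
      have : N - 1 - (N - 1 - j) = j := by have := Finset.mem_range.1 hj; omega
      simp [K, this]
    rw [hEsum, add_apply, h2]
    nth_rewrite 1 [← h1]
    simp [W]
  refine exists_trajectory_of_block hN E K rfl hE hδ0.le hδ1 (fun w => ?_) x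
  set ψ := V ((P ^ N) w) with hψ
  have hWψ : W ψ = (P ^ N) w := by rw [hψ, ← clm_mul_apply W, hV, one_apply_eq_self]
  set q : ℝ := C * ∑ i ∈ Finset.range N, ‖adjoint G ((adjoint P ^ i) ψ)‖ ^ 2 + δ * ‖ψ‖ ^ 2 with hq
  have hq0 : 0 ≤ q := by positivity
  have hqw : q ≤ ‖w‖ * ‖(adjoint P ^ N) ψ‖ := by
    have h1 := hWin ψ
    rw [hWψ, hadj] at h1
    have h2 := norm_inner_le_norm (𝕜 := 𝕜) w ((adjoint P ^ N) ψ)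
    rw [h1, RCLike.norm_ofReal] at h2
    exact (le_abs_self _).trans h2
  -- Observability at `ψ` says `‖(P*)ᴺ ψ‖² ≤ q`, so `q² ≤ ‖w‖² ‖(P*)ᴺ ψ‖² ≤ ‖w‖² q`. The contraction
  -- follows from `δ² ‖ψ‖² ≤ δ q`.
  have hqle : q ≤ ‖w‖ ^ 2 := by
    have h1 := h ψ
    rw [← hq] at h1
    by_contra! hlt
    nlinarith [norm_nonneg w, norm_nonneg ((adjoint P ^ N) ψ),
      mul_self_le_mul_self hq0 hqw, mul_nonneg (sq_nonneg ‖w‖) hq0,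
      mul_le_mul_of_nonneg_left h1 (sq_nonneg ‖w‖)]
  have hδψ : δ * ‖ψ‖ ^ 2 ≤ q := by
    have : 0 ≤ C * ∑ i ∈ Finset.range N, ‖adjoint G ((adjoint P ^ i) ψ)‖ ^ 2 := by positivity
    linarith
  rw [hEN, norm_smul, RCLike.norm_ofReal, abs_of_pos hδ0, mul_pow]
  nlinarith

theorem exists_feedback_of_observability {P : Y →L[𝕜] Y} {G : U →L[𝕜] Y} {N : ℕ} (hN : 0 < N)
    {δ C : ℝ} (hδ0 : 0 < δ) (hδ1 : δ < 1) (hC : 0 ≤ C)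
    (h : ∀ φ, ‖(adjoint P ^ N) φ‖ ^ 2 ≤
      C * ∑ i ∈ Finset.range N, ‖adjoint G ((adjoint P ^ i) φ)‖ ^ 2 + δ * ‖φ‖ ^ 2) :
    ∃ F : Y →L[𝕜] U, ∃ M ω : ℝ, 0 < M ∧ 0 < ω ∧
      ∀ n : ℕ, ‖(P + G ∘L F) ^ n‖ ≤ M * Real.exp (-ω * n) := by
  obtain ⟨F, c, hc, hF⟩ := exists_feedback_sum_sq_le P G
    (exists_trajectory_of_observability hN hδ0 hδ1 hC h)
  exact ⟨F, exists_norm_pow_le_exp hc hF⟩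

/-- Since `(P + G F)* = P* + F* G*`, each further power adds to the difference only a term `F* G*
(P*)ⁿ φ`, controlled by one more observation. -/
theorem exists_norm_adjoint_pow_sub_le (P : Y →L[𝕜] Y) (G : U →L[𝕜] Y) (F : Y →L[𝕜] U) (n : ℕ) :
    ∃ c : ℝ, 0 ≤ c ∧ ∀ φ, ‖(adjoint P ^ n) φ - (adjoint (P + G ∘L F) ^ n) φ‖ ≤
      c * ∑ i ∈ Finset.range n, ‖adjoint G ((adjoint P ^ i) φ)‖ := by
  induction n with
  | zero => exact ⟨0, le_rfl, fun φ => by simp⟩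
  | succ n ih =>
    obtain ⟨c, hc, h⟩ := ih
    set L := adjoint (P + G ∘L F) with hL
    have hLP : ∀ w, L w = adjoint P w + adjoint F (adjoint G w) := fun w => by
      rw [hL, map_add, adjoint_comp]; rfl
    refine ⟨‖L‖ * c + ‖adjoint F‖, by positivity, fun φ => ?_⟩
    set s := ∑ i ∈ Finset.range n, ‖adjoint G ((adjoint P ^ i) φ)‖
    have hs : 0 ≤ s := Finset.sum_nonneg fun _ _ => norm_nonneg _
    rw [Finset.sum_range_succ, pow_succ', pow_succ', clm_mul_apply, clm_mul_apply]
    set a := (adjoint P ^ n) φ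
    have heq : adjoint P a - L ((L ^ n) φ) = L (a - (L ^ n) φ) - adjoint F (adjoint G a) := by
      rw [map_sub, hLP a]; abel
    calc ‖adjoint P a - L ((L ^ n) φ)‖
        ≤ ‖L (a - (L ^ n) φ)‖ + ‖adjoint F (adjoint G a)‖ := by rw [heq]; exact norm_sub_le _ _
      _ ≤ ‖L‖ * (c * s) + ‖adjoint F‖ * ‖adjoint G a‖ :=
        add_le_add (L.le_opNorm_of_le (h φ)) (le_opNorm _ _)
      _ ≤ _ := by
        have h1 : 0 ≤ ‖L‖ * c * ‖adjoint G a‖ := by positivity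
        have h2 : 0 ≤ ‖adjoint F‖ * s := by positivity
        linarith

theorem observability_of_feedback {P : Y →L[𝕜] Y} {G : U →L[𝕜] Y} {F : Y →L[𝕜] U} {M ω : ℝ}
    (hω : 0 < ω) (hF : ∀ n : ℕ, ‖(P + G ∘L F) ^ n‖ ≤ M * Real.exp (-ω * n)) :
    ∃ N : ℕ, 0 < N ∧ ∃ δ : ℝ, 0 < δ ∧ δ < 1 ∧ ∃ C : ℝ, 0 ≤ C ∧ ∀ φ, ‖(adjoint P ^ N) φ‖ ^ 2 ≤
      C * ∑ i ∈ Finset.range N, ‖adjoint G ((adjoint P ^ i) φ)‖ ^ 2 + δ * ‖φ‖ ^ 2 := by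
  have hlim : Tendsto (fun n : ℕ => M * Real.exp (-ω * n)) atTop (𝓝 (M * 0)) := by
    refine Tendsto.const_mul _ (Real.tendsto_exp_atBot.comp ?_)
    exact (tendsto_natCast_atTop_atTop (R := ℝ)).const_mul_atTop_of_neg (neg_lt_zero.2 hω)
  rw [mul_zero] at hlim
  obtain ⟨N, hN, hN0⟩ := ((hlim.eventually_lt_const (by norm_num : (0 : ℝ) < 1 / 2)).and
    (eventually_gt_atTop 0)).exists
  obtain ⟨c, hc, h⟩ := exists_norm_adjoint_pow_sub_le P G F N
  have hL : ‖adjoint (P + G ∘L F) ^ N‖ ≤ 1 / 2 := by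
    rw [← star_eq_adjoint, ← star_pow, star_eq_adjoint, LinearIsometryEquiv.norm_map]
    exact (hF N).trans hN.le
  -- From `(a + b)² ≤ 2a² + 2b²` with `b = ‖φ‖ / 2`; the factor `N` in `C` is from Cauchy–Schwarz.
  refine ⟨N, hN0, 1 / 2, by norm_num, by norm_num, 2 * c ^ 2 * N, by positivity, fun φ => ?_⟩
  set s := ∑ i ∈ Finset.range N, ‖adjoint G ((adjoint P ^ i) φ)‖ with hs
  have hs0 : 0 ≤ s := Finset.sum_nonneg fun _ _ => norm_nonneg _
  have hcs : s ^ 2 ≤ N * ∑ i ∈ Finset.range N, ‖adjoint G ((adjoint P ^ i) φ)‖ ^ 2 := by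
    have := sq_sum_le_card_mul_sum_sq (s := Finset.range N)
      (f := fun i => ‖adjoint G ((adjoint P ^ i) φ)‖)
    rwa [Finset.card_range] at this
  have h1 : ‖(adjoint P ^ N) φ‖ ≤ c * s + 1 / 2 * ‖φ‖ := by
    calc ‖(adjoint P ^ N) φ‖ = ‖((adjoint P ^ N) φ - (adjoint (P + G ∘L F) ^ N) φ)
          + (adjoint (P + G ∘L F) ^ N) φ‖ := by rw [sub_add_cancel]
      _ ≤ _ := (norm_add_le _ _).trans (add_le_add (h φ) (le_of_opNorm_le _ hL φ))
  have h2 : ‖(adjoint P ^ N) φ‖ ^ 2 ≤ (c * s + 1 / 2 * ‖φ‖) ^ 2 := by gcongr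
  have h3 := mul_le_mul_of_nonneg_left hcs (by positivity : 0 ≤ 2 * c ^ 2)
  nlinarith [sq_nonneg (c * s - 1 / 2 * ‖φ‖)]

end Discrete

/-! ### Strong measurability from weak continuity. -/

section WeakMeasurability

open scoped InnerProductSpace

variable {𝕜 : Type*} [RCLike 𝕜] {H : Type*} [NormedAddCommGroup H] [InnerProductSpace 𝕜 H]
  [CompleteSpace H]

/-- A weakly continuous function from a second-countable space to a Hilbert space is strongly
measurable. -/
theorem stronglyMeasurable_of_continuous_inner {α : Type*} [TopologicalSpace α]
    [SecondCountableTopology α] [MeasurableSpace α] [OpensMeasurableSpace α]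
    [Nonempty α] {f : α → H} (hf : ∀ v : H, Continuous fun t => ⟪v, f t⟫_𝕜) :
    StronglyMeasurable f := by
  let q := TopologicalSpace.denseSeq α
  let V : ℕ → Submodule 𝕜 H := fun n => Submodule.span 𝕜 ((fun k => f (q k)) '' Set.Iic n)
  have hfin : ∀ n, FiniteDimensional 𝕜 (V n) := fun n =>
    FiniteDimensional.span_of_finite 𝕜 ((Set.finite_Iic n).image _)
  have hmono : Monotone V := fun m n hmn =>
    Submodule.span_mono (Set.image_mono (Set.Iic_subset_Iic.2 hmn))
  let W := (⨆ n, V n).topologicalClosure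
  have : CompleteSpace W := (Submodule.isClosed_topologicalClosure _).completeSpace_coe
  have hq : ∀ k, f (q k) ∈ W := fun k =>
    Submodule.le_topologicalClosure _ (Submodule.mem_iSup_of_mem k
      (Submodule.subset_span ⟨k, Set.mem_Iic.2 le_rfl, rfl⟩))
  -- A vector orthogonal to the values on a dense sequence is orthogonal to all values, by weak
  -- continuity.
  have hW : ∀ t, f t ∈ W := by
    intro t
    have hWW : Wᗮᗮ = W := Submodule.orthogonal_orthogonal W
    rw [← hWW, Submodule.mem_orthogonal]
    intro v hv
    have hzero : (fun t => ⟪v, f t⟫_𝕜) = fun _ => 0 :=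
      (TopologicalSpace.denseRange_denseSeq α).equalizer (hf v) continuous_const
        (funext fun k => Submodule.inner_left_of_mem_orthogonal (hq k) hv)
    exact congr_fun hzero t
  -- Projected to a finite-dimensional subspace, a weakly continuous function is norm continuous;
  -- the projections converge pointwise to `f`.
  refine stronglyMeasurable_of_tendsto atTop (f := fun n t => (V n).starProjection (f t))
    (fun n => ?_) ?_
  · refine Continuous.stronglyMeasurable ?_
    let b := stdOrthonormalBasis 𝕜 (V n)
    have : (fun t => (V n).starProjection (f t)) = fun t => ∑ i, ⟪(b i : H), f t⟫_𝕜 • (b i : H) := by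
      funext t
      rw [b.starProjection_eq_sum_rankOne, sum_apply]
      simp
    rw [this]
    exact continuous_finsetSum _ fun i _ => (hf _).smul continuous_const
  · rw [tendsto_pi_nhds]
    intro t
    have := Submodule.starProjection_tendsto_closure_iSup V hmono (f t)
    rwa [Submodule.starProjection_eq_self_iff.2 (hW t)] at this

end WeakMeasurability

/-! ### Semigroup bounds and the partition of time into periods. -/

namespace C0Semigroup

variable {𝕜 : Type*} [RCLike 𝕜] {Y : Type*} [NormedAddCommGroup Y]

theorem exists_norm_op_le [NormedSpace 𝕜 Y] [CompleteSpace Y] (S : C0Semigroup 𝕜 Y) (T : ℝ) :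
    ∃ K : ℝ, 0 ≤ K ∧ ∀ t ∈ Icc 0 T, ‖S.op t‖ ≤ K := by
  obtain ⟨K, hK⟩ := banach_steinhaus (g := fun t : Icc (0 : ℝ) T => S.op t) fun x => by
    obtain ⟨C, hC⟩ := isCompact_Icc.exists_bound_of_continuousOn
      ((S.continuousOn_orbit x).mono (Icc_subset_Ici_self : Icc 0 T ⊆ Ici 0))
    exact ⟨C, fun t => hC t t.2⟩
  exact ⟨max K 0, le_max_right _ _, fun t ht => (hK ⟨t, ht⟩).trans (le_max_left _ _)⟩

theorem op_nat_mul [NormedSpace 𝕜 Y] (S : C0Semigroup 𝕜 Y) {T : ℝ} (hT : 0 ≤ T) (n : ℕ) :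
    S.op (n * T) = S.op T ^ n := by
  induction n with
  | zero => rw [Nat.cast_zero, zero_mul, S.op_zero]; rfl
  | succ n ih =>
    rw [Nat.cast_succ, add_one_mul, S.op_add _ _ (by positivity) hT, ih, pow_succ]
    rfl

theorem op_add_apply [NormedSpace 𝕜 Y] (S : C0Semigroup 𝕜 Y) {s t : ℝ} (hs : 0 ≤ s) (ht : 0 ≤ t)
    (x : Y) : S.op (s + t) x = S.op s (S.op t x) := by
  rw [S.op_add s t hs ht]; rfl

theorem intervalIntegrable_op_apply [NormedSpace 𝕜 Y] (S : C0Semigroup 𝕜 Y) {a b : ℝ}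
    (ha : 0 ≤ a) (hb : 0 ≤ b) (x : Y) : IntervalIntegrable (fun t => S.op t x) volume a b :=
  ((S.continuousOn_orbit x).mono fun _ ht => (le_min ha hb).trans ht.1).intervalIntegrable

end C0Semigroup

/-- Only finitely many sampling periods meet `[0, t]`, so the integrand is a finite sum of
continuous functions cut off to measurable sets. -/
theorem integrableOn_floor_div {E : Type*} [NormedAddCommGroup E] {g : ℕ → ℝ → E} {T t : ℝ}
    (hT : 0 < T) (hg : ∀ k, ContinuousOn (g k) (Icc 0 t)) :
    IntegrableOn (fun s => g ⌊s / T⌋₊ s) (Icc 0 t) := by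
  let A : ℕ → Set ℝ := fun k => (fun s : ℝ => ⌊s / T⌋₊) ⁻¹' {k}
  have hA : ∀ k, MeasurableSet (A k) := fun k =>
    (Nat.measurable_floor.comp (measurable_id.div_const T)) (measurableSet_singleton k)
  have hint : IntegrableOn (fun s => ∑ k ∈ Finset.range (⌊t / T⌋₊ + 1), (A k).indicator (g k) s)
      (Icc 0 t) :=
    integrable_finsetSum _ fun k _ =>
      ((hg k).integrableOn_compact isCompact_Icc).indicator (hA k)
  refine hint.congr_fun (fun s hs => ?_) measurableSet_Icc
  have hle : ⌊s / T⌋₊ ≤ ⌊t / T⌋₊ := Nat.floor_mono (by gcongr; exact hs.2)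
  beta_reduce
  rw [Finset.sum_eq_single ⌊s / T⌋₊]
  · exact indicator_of_mem (show s ∈ A ⌊s / T⌋₊ from rfl) _
  · intro k _ hk
    exact indicator_of_notMem (fun h : s ∈ A k => hk (Eq.symm h)) _
  · intro h
    exact absurd (Finset.mem_range.2 (Nat.lt_succ_of_le hle)) h

theorem floor_div_eq {T s : ℝ} (hT : 0 < T) {k : ℕ} (h1 : k * T ≤ s) (h2 : s < (k + 1) * T) :
    ⌊s / T⌋₊ = k := by
  rw [Nat.floor_eq_iff (div_nonneg (le_trans (by positivity) h1) hT.le), le_div_iff₀ hT,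
    div_lt_iff₀ hT]
  exact ⟨h1, h2⟩

theorem exists_eq_nat_mul_add {T t : ℝ} (hT : 0 < T) (ht : 0 ≤ t) :
    ∃ k : ℕ, ∃ τ ∈ Icc 0 T, t = k * T + τ := by
  have h0 : 0 ≤ t / T := by positivity
  have h1 := Nat.floor_le h0
  have h2 := (Nat.lt_floor_add_one (t / T)).le
  rw [le_div_iff₀ hT] at h1
  rw [div_le_iff₀ hT] at h2
  exact ⟨⌊t / T⌋₊, t - ⌊t / T⌋₊ * T, ⟨by linarith, by linarith⟩, by ring⟩

theorem continuousOn_Ici_of_Icc_nat_mul {E : Type*} [TopologicalSpace E] {f : ℝ → E} {T : ℝ}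
    (hT : 0 < T) (h : ∀ k : ℕ, ContinuousOn f (Icc (k * T) (k * T + T))) :
    ContinuousOn f (Ici 0) := by
  have hn : ∀ k : ℕ, ContinuousOn f (Icc 0 (k * T)) := by
    intro k
    induction k with
    | zero => simp
    | succ k ih =>
      have := ih.union_of_isClosed (h k) isClosed_Icc isClosed_Icc
      rwa [Icc_union_Icc_eq_Icc (by positivity) (by linarith), ← add_one_mul,
        ← Nat.cast_succ] at this
  intro t ht
  obtain ⟨k, hk⟩ := exists_nat_gt (t / T)
  rw [div_lt_iff₀ hT] at hk
  refine (hn k t ⟨ht, hk.le⟩).mono_of_mem_nhdsWithin ?_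
  filter_upwards [self_mem_nhdsWithin, mem_nhdsWithin_of_mem_nhds (Iio_mem_nhds hk)] with s h1 h2
  exact ⟨h1, (mem_Iio.1 h2).le⟩

/-! ### Mild solutions under piecewise constant controls. -/

namespace ControlSystem

open ContinuousLinearMap
open scoped InnerProductSpace

variable {𝕜 : Type*} [RCLike 𝕜] {Y U : Type*}
  [NormedAddCommGroup Y] [InnerProductSpace 𝕜 Y] [CompleteSpace Y] [NormedSpace ℝ Y]
  [NormedAddCommGroup U] [InnerProductSpace 𝕜 U] [CompleteSpace U] [NormedSpace ℝ U]

theorem norm_integral_op_le (sys : ControlSystem 𝕜 Y U) {K T τ : ℝ} (hK0 : 0 ≤ K)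
    (hK : ∀ t ∈ Icc 0 T, ‖sys.S.op t‖ ≤ K) (hτ : τ ∈ Icc 0 T) (u : U) :
    ‖∫ s in (0 : ℝ)..τ, sys.S.op s (sys.B u)‖ ≤ K * T * ‖sys.B‖ * ‖u‖ := by
  have h : ∀ s ∈ uIoc 0 τ, ‖sys.S.op s (sys.B u)‖ ≤ K * (‖sys.B‖ * ‖u‖) := by
    intro s hs
    rw [uIoc_of_le hτ.1] at hs
    exact (sys.S.op s).le_of_opNorm_le_of_le (hK s ⟨hs.1.le, hs.2.trans hτ.2⟩) (sys.B.le_opNorm u)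
  refine (intervalIntegral.norm_integral_le_of_norm_le_const h).trans ?_
  rw [sub_zero, abs_of_nonneg hτ.1]
  calc K * (‖sys.B‖ * ‖u‖) * τ ≤ K * (‖sys.B‖ * ‖u‖) * T := by gcongr; exact hτ.2
    _ = _ := by ring

/-- The operator `u ↦ ∫₀ᵀ S(s) B u ds`: the effect over one sampling period of a constant
control. -/
theorem exists_constantControlOp (sys : ControlSystem 𝕜 Y U) {T : ℝ} (hT : 0 ≤ T) :
    ∃ G : U →L[𝕜] Y, ∀ u, G u = ∫ s in (0 : ℝ)..T, sys.S.op s (sys.B u) := by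
  obtain ⟨K, hK0, hK⟩ := sys.S.exists_norm_op_le T
  let G : U →ₗ[𝕜] Y :=
    { toFun := fun u => ∫ s in (0 : ℝ)..T, sys.S.op s (sys.B u)
      map_add' := fun u v => by
        simp only [map_add]
        exact intervalIntegral.integral_add (sys.S.intervalIntegrable_op_apply le_rfl hT _)
          (sys.S.intervalIntegrable_op_apply le_rfl hT _)
      map_smul' := fun c u => by
        simp only [map_smul, RingHom.id_apply]
        exact (c • ContinuousLinearMap.id 𝕜 Y).intervalIntegral_comp_comm
          (sys.S.intervalIntegrable_op_apply le_rfl hT _) }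
  exact ⟨G.mkContinuous (K * T * ‖sys.B‖) fun u =>
    sys.norm_integral_op_le hK0 hK ⟨hT, le_rfl⟩ u, fun u => rfl⟩

/-- The mild solution for the control that is equal to `v k` on `[k T, (k + 1) T)`. -/
noncomputable def sampledMild (sys : ControlSystem 𝕜 Y U) (T : ℝ) (v : ℕ → U) (y₀ : Y) (t : ℝ) :
    Y :=
  sys.S.op t y₀ + ∫ s in (0 : ℝ)..t, sys.S.op (t - s) (sys.B (v ⌊s / T⌋₊))

theorem integrableOn_sampled (sys : ControlSystem 𝕜 Y U) {T : ℝ} (hT : 0 < T) (v : ℕ → U)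
    (t : ℝ) : IntegrableOn (fun s => sys.S.op (t - s) (sys.B (v ⌊s / T⌋₊))) (Icc 0 t) :=
  integrableOn_floor_div (g := fun k s => sys.S.op (t - s) (sys.B (v k))) hT fun k =>
    (sys.S.continuousOn_orbit _).comp (by fun_prop) fun _ hs => sub_nonneg.2 hs.2

theorem sampledMild_zero (sys : ControlSystem 𝕜 Y U) (T : ℝ) (v : ℕ → U) (y₀ : Y) :
    sys.sampledMild T v y₀ 0 = y₀ := by
  simp [sampledMild, sys.S.op_zero]

theorem sampledMild_nat_mul_add (sys : ControlSystem 𝕜 Y U) {T : ℝ} (hT : 0 < T) (v : ℕ → U)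
    (y₀ : Y) (k : ℕ) {τ : ℝ} (hτ : τ ∈ Icc 0 T) :
    sys.sampledMild T v y₀ (k * T + τ) =
      sys.S.op τ (sys.sampledMild T v y₀ (k * T)) +
        ∫ s in (0 : ℝ)..τ, sys.S.op s (sys.B (v k)) := by
  have ha : 0 ≤ (k : ℝ) * T := by positivity
  set a : ℝ := k * T with hadef
  have hat : a ≤ a + τ := by linarith [hτ.1]
  have hint := sys.integrableOn_sampled hT v (a + τ)
  have h1 : IntervalIntegrable (fun s => sys.S.op (a + τ - s) (sys.B (v ⌊s / T⌋₊))) volume 0 a :=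
    IntegrableOn.intervalIntegrable (by
      rw [uIcc_of_le ha]; exact hint.mono_set (Icc_subset_Icc_right hat))
  have h2 : IntervalIntegrable (fun s => sys.S.op (a + τ - s) (sys.B (v ⌊s / T⌋₊))) volume
      a (a + τ) :=
    IntegrableOn.intervalIntegrable (by
      rw [uIcc_of_le hat]; exact hint.mono_set (Icc_subset_Icc_left ha))
  have h3 : IntervalIntegrable (fun s => sys.S.op (a - s) (sys.B (v ⌊s / T⌋₊))) volume 0 a :=
    IntegrableOn.intervalIntegrable (by
      rw [uIcc_of_le ha]; exact sys.integrableOn_sampled hT v a)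
  have e1 : ∫ s in (0 : ℝ)..a, sys.S.op (a + τ - s) (sys.B (v ⌊s / T⌋₊)) =
      sys.S.op τ (∫ s in (0 : ℝ)..a, sys.S.op (a - s) (sys.B (v ⌊s / T⌋₊))) := by
    rw [← (sys.S.op τ).intervalIntegral_comp_comm h3]
    refine intervalIntegral.integral_congr fun s hs => ?_
    rw [uIcc_of_le ha] at hs
    rw [← sys.S.op_add_apply hτ.1 (sub_nonneg.2 hs.2)]
    congr 2
    ring
  have e2 : ∫ s in a..(a + τ), sys.S.op (a + τ - s) (sys.B (v ⌊s / T⌋₊)) =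
      ∫ s in (0 : ℝ)..τ, sys.S.op s (sys.B (v k)) := by
    have : ∫ s in a..(a + τ), sys.S.op (a + τ - s) (sys.B (v ⌊s / T⌋₊)) =
        ∫ s in a..(a + τ), sys.S.op (a + τ - s) (sys.B (v k)) := by
      -- For `τ = T` the floor jumps at the right endpoint; passing to the open interval discards
      -- this null set, so the formula reaches the next sampling instant.
      rw [intervalIntegral.integral_of_le hat, intervalIntegral.integral_of_le hat,
        integral_Ioc_eq_integral_Ioo, integral_Ioc_eq_integral_Ioo]
      refine setIntegral_congr_fun measurableSet_Ioo fun s hs => ?_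
      rw [floor_div_eq hT hs.1.le (by linarith [hs.2, hτ.2])]
    rw [this, intervalIntegral.integral_comp_sub_left (fun s => sys.S.op s (sys.B (v k)))]
    simp
  rw [sampledMild, sampledMild, ← intervalIntegral.integral_add_adjacent_intervals h1 h2, e1, e2,
    map_add, add_comm a τ, sys.S.op_add_apply hτ.1 ha, add_assoc]

theorem continuousOn_sampledMild (sys : ControlSystem 𝕜 Y U) {T : ℝ} (hT : 0 < T) (v : ℕ → U)
    (y₀ : Y) : ContinuousOn (sys.sampledMild T v y₀) (Ici 0) := by
  refine continuousOn_Ici_of_Icc_nat_mul hT fun k => ?_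
  have hmaps : MapsTo (fun t : ℝ => t - k * T) (Icc (k * T) (k * T + T)) (Icc 0 T) :=
    fun t ht => ⟨by linarith [ht.1], by linarith [ht.2]⟩
  have h1 : ContinuousOn (fun τ => sys.S.op τ (sys.sampledMild T v y₀ (k * T)) +
        ∫ s in (0 : ℝ)..τ, sys.S.op s (sys.B (v k))) (Icc 0 T) := by
    refine ((sys.S.continuousOn_orbit _).mono Icc_subset_Ici_self).add ?_
    have := intervalIntegral.continuousOn_primitive_interval (μ := volume) (a := 0) (b := T)
      (f := fun s => sys.S.op s (sys.B (v k))) (by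
        rw [uIcc_of_le hT.le]
        exact ((sys.S.continuousOn_orbit _).mono Icc_subset_Ici_self).integrableOn_compact
          isCompact_Icc)
    rwa [uIcc_of_le hT.le] at this
  refine (h1.comp (by fun_prop) hmaps).congr fun t ht => ?_
  have := sys.sampledMild_nat_mul_add hT v y₀ k (hmaps ht)
  rwa [add_sub_cancel] at this

/-! ### Reduction of the closed loop to powers of `S(T) + G F`. -/

variable {sys : ControlSystem 𝕜 Y U} {T : ℝ} {F : Y →L[𝕜] U} {G : U →L[𝕜] Y}

theorem IsSampledClosedLoopSolution.eq_sampledMild {y₀ : Y} {y : ℝ → Y}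
    (h : sys.IsSampledClosedLoopSolution T F y₀ y) {t : ℝ} (ht : 0 ≤ t) :
    y t = sys.sampledMild T (fun k => F (y (k * T))) y₀ t :=
  h.2.2 t ht

theorem IsSampledClosedLoopSolution.apply_nat_mul_add (hT : 0 < T) {y₀ : Y} {y : ℝ → Y}
    (h : sys.IsSampledClosedLoopSolution T F y₀ y) (k : ℕ) {τ : ℝ} (hτ : τ ∈ Icc 0 T) :
    y (k * T + τ) = sys.S.op τ (y (k * T)) +
      ∫ s in (0 : ℝ)..τ, sys.S.op s (sys.B (F (y (k * T)))) := by
  have ha : 0 ≤ (k : ℝ) * T := by positivity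
  have := sys.sampledMild_nat_mul_add hT (fun k => F (y (k * T))) y₀ k hτ
  rwa [← h.eq_sampledMild (add_nonneg ha hτ.1), ← h.eq_sampledMild ha] at this

theorem IsSampledClosedLoopSolution.apply_nat_mul (hT : 0 < T)
    (hG : ∀ u, G u = ∫ s in (0 : ℝ)..T, sys.S.op s (sys.B u)) {y₀ : Y} {y : ℝ → Y}
    (h : sys.IsSampledClosedLoopSolution T F y₀ y) (k : ℕ) :
    y (k * T) = ((sys.S.op T + G ∘L F) ^ k) y₀ := by
  induction k with
  | zero =>
    rw [Nat.cast_zero, zero_mul, h.eq_sampledMild le_rfl, sampledMild_zero]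
    rfl
  | succ k ih =>
    rw [Nat.cast_succ, add_one_mul, h.apply_nat_mul_add hT k ⟨hT.le, le_rfl⟩, ← hG, ih, pow_succ',
      clm_mul_apply]
    rfl

theorem exists_isSampledClosedLoopSolution (hT : 0 < T)
    (hG : ∀ u, G u = ∫ s in (0 : ℝ)..T, sys.S.op s (sys.B u)) (F : Y →L[𝕜] U) (y₀ : Y) :
    ∃ y : ℝ → Y, sys.IsSampledClosedLoopSolution T F y₀ y := by
  set L := sys.S.op T + G ∘L F with hL
  -- The samples of the solution are known in advance, so the feedback can be prescribed as an
  -- open-loop control and then checked to agree.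
  let v : ℕ → U := fun k => F ((L ^ k) y₀)
  have hy : ∀ k : ℕ, sys.sampledMild T v y₀ (k * T) = (L ^ k) y₀ := by
    intro k
    induction k with
    | zero => rw [Nat.cast_zero, zero_mul, sampledMild_zero]; rfl
    | succ k ih =>
      rw [Nat.cast_succ, add_one_mul, sys.sampledMild_nat_mul_add hT v y₀ k ⟨hT.le, le_rfl⟩, ← hG,
        ih, pow_succ', clm_mul_apply]
      rfl
  have hu : ∀ t, F (samplePeriodic T (sys.sampledMild T v y₀) t) = v ⌊t / T⌋₊ := fun t => by
    rw [samplePeriodic, hy]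
  refine ⟨sys.sampledMild T v y₀, fun t ht => ?_, sys.continuousOn_sampledMild hT v y₀,
    fun t _ => ?_⟩
  · simp only [hu]
    refine IntegrableOn.intervalIntegrable ?_
    rw [uIcc_of_le ht]
    exact integrableOn_floor_div (g := fun k _ => v k) hT fun k => continuousOn_const
  · simp only [hu]
    rfl

theorem isDCStabilizable_iff_exists_powerStable (hT : 0 < T)
    (hG : ∀ u, G u = ∫ s in (0 : ℝ)..T, sys.S.op s (sys.B u)) :
    sys.IsDCStabilizable T ↔ ∃ F : Y →L[𝕜] U, ∃ M ω : ℝ, 0 < M ∧ 0 < ω ∧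
      ∀ n : ℕ, ‖(sys.S.op T + G ∘L F) ^ n‖ ≤ M * Real.exp (-ω * n) := by
  constructor
  · rintro ⟨F, M, ω, hM, hω, h⟩
    refine ⟨F, M, ω * T, hM, by positivity, fun n => opNorm_le_bound _ (by positivity) fun y₀ => ?_⟩
    obtain ⟨⟨y, hy⟩, hdecay⟩ := h y₀
    have := hdecay y hy (n * T) (by positivity)
    rw [hy.apply_nat_mul hT hG] at this
    convert this using 4
    ring
  · rintro ⟨F, M, ω, hM, hω, h⟩
    obtain ⟨K, hK0, hK⟩ := sys.S.exists_norm_op_le T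
    set c : ℝ := K + K * T * ‖sys.B‖ * ‖F‖ + 1 with hc
    have hc0 : 0 < c := by positivity
    -- `c` bounds the growth within one period, and `exp ω` pays for the time elapsed since the last
    -- sample.
    refine ⟨F, c * M * Real.exp ω, ω / T, by positivity, by positivity, fun y₀ =>
      ⟨exists_isSampledClosedLoopSolution hT hG F y₀, fun y hy t ht => ?_⟩⟩
    obtain ⟨k, τ, hτ, rfl⟩ := exists_eq_nat_mul_add hT ht
    have hk : ‖y (k * T)‖ ≤ M * Real.exp (-ω * k) * ‖y₀‖ := by
      rw [hy.apply_nat_mul hT hG]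
      exact le_of_opNorm_le _ (h k) y₀
    have hexp : Real.exp (-ω * k) ≤ Real.exp ω * Real.exp (-(ω / T) * (k * T + τ)) := by
      rw [← Real.exp_add, Real.exp_le_exp]
      have h1 : ω / T * (k * T + τ) = ω * k + ω * (τ / T) := by field_simp
      have h2 : τ / T ≤ 1 := (div_le_one hT).2 hτ.2
      have h3 := mul_le_mul_of_nonneg_left h2 hω.le
      linarith
    calc ‖y (k * T + τ)‖ ≤ ‖sys.S.op τ (y (k * T))‖ +
          ‖∫ s in (0 : ℝ)..τ, sys.S.op s (sys.B (F (y (k * T))))‖ := by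
          rw [hy.apply_nat_mul_add hT k hτ]; exact norm_add_le _ _
      _ ≤ K * ‖y (k * T)‖ + K * T * ‖sys.B‖ * (‖F‖ * ‖y (k * T)‖) := by
          refine add_le_add (le_of_opNorm_le _ (hK τ hτ) _)
            ((sys.norm_integral_op_le hK0 hK hτ _).trans ?_)
          gcongr
          exact F.le_opNorm _
      _ ≤ c * ‖y (k * T)‖ := by
          rw [hc]
          linarith [norm_nonneg (y (k * T))]
      _ ≤ c * (M * (Real.exp ω * Real.exp (-(ω / T) * (k * T + τ))) * ‖y₀‖) := by
          refine mul_le_mul_of_nonneg_left (hk.trans ?_) hc0.le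
          gcongr
      _ = _ := by ring

/-! ### Adjoint integrals as discrete observations. -/

theorem intervalIntegrable_adjoint_op (sys : ControlSystem 𝕜 Y U) {a b : ℝ} (ha : 0 ≤ a)
    (hab : a ≤ b) (φ : Y) :
    IntervalIntegrable (fun t => adjoint sys.B (adjoint (sys.S.op t) φ)) volume a b := by
  obtain ⟨K, hK0, hK⟩ := sys.S.exists_norm_op_le b
  -- Moving the adjoints across the inner product gives weak continuity at once; `max t 0` avoids
  -- the unconstrained values at negative times.
  have hmeas : StronglyMeasurable
      fun t : ℝ => adjoint sys.B (adjoint (sys.S.op (max t 0)) φ) := by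
    refine stronglyMeasurable_of_continuous_inner (𝕜 := 𝕜) fun u => ?_
    simp only [adjoint_inner_right]
    have : Continuous fun t : ℝ => sys.S.op (max t 0) (sys.B u) :=
      (sys.S.continuousOn_orbit _).comp_continuous (by fun_prop) fun t =>
        mem_Ici.2 (le_max_right t 0)
    exact this.inner continuous_const
  have hint : IntervalIntegrable
      (fun t : ℝ => adjoint sys.B (adjoint (sys.S.op (max t 0)) φ)) volume a b := by
    refine (intervalIntegrable_const (c := ‖adjoint sys.B‖ * (K * ‖φ‖))).mono_fun'
      hmeas.aestronglyMeasurable ?_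
    refine (ae_restrict_iff' measurableSet_uIoc).2 (Eventually.of_forall fun t ht => ?_)
    rw [uIoc_of_le hab] at ht
    have ht0 : 0 ≤ t := ha.trans ht.1.le
    beta_reduce
    rw [max_eq_left ht0]
    refine le_opNorm_of_le _ (le_of_opNorm_le _ ?_ φ)
    rw [LinearIsometryEquiv.norm_map]
    exact hK t ⟨ht0, ht.2⟩
  refine (intervalIntegrable_congr fun t ht => ?_).1 hint
  rw [uIoc_of_le hab] at ht
  rw [max_eq_left (ha.trans ht.1.le)]

/-- Tested against `u`, both sides equal `⟪S(kT) G u, φ⟫`, because `S(kT)` shifts the integral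
defining `G u` to the period starting at `kT`. -/
theorem integral_adjoint_op (hT : 0 ≤ T)
    (hG : ∀ u, G u = ∫ s in (0 : ℝ)..T, sys.S.op s (sys.B u)) (k : ℕ) (φ : Y) :
    ∫ t in (k * T)..(k * T + T), adjoint sys.B (adjoint (sys.S.op t) φ) =
      adjoint G ((adjoint (sys.S.op T) ^ k) φ) := by
  have ha : 0 ≤ (k : ℝ) * T := by positivity
  refine ext_inner_left 𝕜 fun u => ?_
  have hint := sys.intervalIntegrable_adjoint_op ha (by linarith : k * T ≤ k * T + T) φ
  have h1 : ⟪u, ∫ t in (k * T)..(k * T + T), adjoint sys.B (adjoint (sys.S.op t) φ)⟫_𝕜 =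
      ∫ t in (k * T)..(k * T + T), ⟪sys.S.op t (sys.B u), φ⟫_𝕜 := by
    have := (innerSL 𝕜 u).intervalIntegral_comp_comm hint
    simp only [innerSL_apply_apply, adjoint_inner_right] at this
    exact this.symm
  have h2 : adjoint (sys.S.op T) ^ k = adjoint (sys.S.op (k * T)) := by
    rw [sys.S.op_nat_mul hT, ← star_eq_adjoint, ← star_eq_adjoint, star_pow]
  have h3 : sys.S.op (k * T) (G u) = ∫ t in (k * T)..(k * T + T), sys.S.op t (sys.B u) := by
    rw [hG, ← (sys.S.op (k * T)).intervalIntegral_comp_comm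
      (sys.S.intervalIntegrable_op_apply le_rfl hT _)]
    have e : ∫ s in (0 : ℝ)..T, sys.S.op (k * T) (sys.S.op s (sys.B u)) =
        ∫ s in (0 : ℝ)..T, sys.S.op (k * T + s) (sys.B u) := by
      refine intervalIntegral.integral_congr fun s hs => ?_
      rw [uIcc_of_le hT] at hs
      exact (sys.S.op_add_apply ha hs.1 _).symm
    rw [e, intervalIntegral.integral_comp_add_left (fun s => sys.S.op s (sys.B u)), add_zero]
  have h4 : ⟪∫ t in (k * T)..(k * T + T), sys.S.op t (sys.B u), φ⟫_𝕜 =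
      ∫ t in (k * T)..(k * T + T), ⟪sys.S.op t (sys.B u), φ⟫_𝕜 := by
    have hi := sys.S.intervalIntegrable_op_apply ha (add_nonneg ha hT) (sys.B u)
    have := (innerSL 𝕜 φ).intervalIntegral_comp_comm hi
    simp only [innerSL_apply_apply] at this
    -- Only the second slot of the inner product is linear, so the integral is pulled out there and
    -- then conjugated.
    have h5 := congrArg (starRingEnd 𝕜) this
    rw [inner_conj_symm, ← intervalIntegral.intervalIntegral_conj] at h5
    simpa only [inner_conj_symm] using h5.symm
  rw [h1, h2, adjoint_inner_right, adjoint_inner_right, h3, h4]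

/-- The observability inequality of the sampled system is that of the discrete-time pair
`(S(T), G)`. -/
theorem observability_iff_discrete (hT : 0 ≤ T)
    (hG : ∀ u, G u = ∫ s in (0 : ℝ)..T, sys.S.op s (sys.B u)) (N : ℕ) (C δ : ℝ) (φ : Y) :
    ‖adjoint (sys.S.op ((N : ℝ) * T)) φ‖ ^ 2 ≤
        C * ∑ i ∈ Finset.Icc 1 N,
            ‖∫ t in (((i : ℝ) - 1) * T)..((i : ℝ) * T),
                adjoint sys.B (adjoint (sys.S.op t) φ)‖ ^ 2
          + δ * ‖φ‖ ^ 2 ↔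
      ‖(adjoint (sys.S.op T) ^ N) φ‖ ^ 2 ≤
        C * ∑ i ∈ Finset.range N, ‖adjoint G ((adjoint (sys.S.op T) ^ i) φ)‖ ^ 2
          + δ * ‖φ‖ ^ 2 := by
  have h1 : adjoint (sys.S.op (N * T)) = adjoint (sys.S.op T) ^ N := by
    rw [sys.S.op_nat_mul hT, ← star_eq_adjoint, ← star_eq_adjoint, star_pow]
  have h2 : ∑ i ∈ Finset.Icc 1 N, ‖∫ t in (((i : ℝ) - 1) * T)..((i : ℝ) * T),
      adjoint sys.B (adjoint (sys.S.op t) φ)‖ ^ 2 =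
      ∑ i ∈ Finset.range N, ‖adjoint G ((adjoint (sys.S.op T) ^ i) φ)‖ ^ 2 := by
    rw [Finset.range_eq_Ico, Finset.sum_Ico_eq_sum_range]
    rw [← Finset.Ico_add_one_right_eq_Icc, Finset.sum_Ico_eq_sum_range]
    refine Finset.sum_congr rfl fun k _ => ?_
    rw [zero_add, ← integral_adjoint_op hT hG k φ]
    congr 3
    · push_cast; ring
    · push_cast; ring
  rw [h1, h2]

end ControlSystem

open ContinuousLinearMap in
theorem corollary1p7 {𝕜 : Type*} [RCLike 𝕜] {Y U : Type*}
    [NormedAddCommGroup Y] [InnerProductSpace 𝕜 Y] [CompleteSpace Y] [NormedSpace ℝ Y]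
    [NormedAddCommGroup U] [InnerProductSpace 𝕜 U] [CompleteSpace U] [NormedSpace ℝ U]
    (sys : ControlSystem 𝕜 Y U) :
    (∀ T : ℝ, 0 < T → sys.IsDCStabilizable T) ↔
      ∀ T : ℝ, 0 < T → ∃ N : ℕ, 0 < N ∧ ∃ δ : ℝ, 0 < δ ∧ δ < 1 ∧ ∃ C : ℝ, 0 ≤ C ∧
        ∀ φ : Y, ‖adjoint (sys.S.op ((N : ℝ) * T)) φ‖ ^ 2 ≤
          C * ∑ i ∈ Finset.Icc 1 N,
              ‖∫ t in (((i : ℝ) - 1) * T)..((i : ℝ) * T),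
                  adjoint sys.B (adjoint (sys.S.op t) φ)‖ ^ 2
            + δ * ‖φ‖ ^ 2 := by
  refine forall_congr' fun T => forall_congr' fun hT => ?_
  obtain ⟨G, hG⟩ := sys.exists_constantControlOp hT.le
  simp only [ControlSystem.observability_iff_discrete hT.le hG]
  rw [ControlSystem.isDCStabilizable_iff_exists_powerStable hT hG]
  constructor
  · rintro ⟨F, M, ω, _, hω, h⟩
    exact observability_of_feedback hω h
  · rintro ⟨N, hN, δ, hδ0, hδ1, C, hC, h⟩
    exact exists_feedback_of_observability hN hδ0 hδ1 hC h
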